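/- Let $S$ be a set and let $W$ be a set of walls on $S$, i.e. bipartitions $h=\{h^+,h^-\}$ of $S$ into two complementary halfspaces. Two walls $h,k$ cross if all four intersections $h^\pm\cap k^\pm$ are nonempty. A set $c$ of walls is a chain if it can be listed as a (finite, or infinite in one or both directions) sequence of distinct walls $(h_i)$ with halfspaces labelled so that $h_i^-\subset h_{i+1}^-$ for all $i$. An ultrafilter on $W$ is a choice $x(h)\in\{h^+,h^-\}$ of a halfspace of each $h\in W$ such that, whenever $x(h)\subset B$ for a halfspace $B$ of a wall $k$, one has $x(k)=B$. Each $s\in S$ gives the ultrafilter $\phi_s$ that chooses the halfspaces containing $s$. A set $c\subset W$ separates ultrafilters $x,y$ if $x(h)\neq y(h)$ for all $h\in c$. For $\mathcal D\subset 2^W$ put $\mathrm{dist}_{\mathcal D}(x,y)=\sup\{|c| : c\in\mathcal D \text{ separates } x \text{ from } y\}\in\mathbf N\cup\{\infty\}$. Let $\mathcal D\subset 2^W$ be a dualisable system of chains: $\mathcal D$ is closed under taking subsets, $\{h\}\in\mathcal D$ for every $h\in W$, $\mathrm{dist}_{\mathcal D}(\phi_s,\phi_t)<\infty$ for all $s,t\in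 S$, and every element of $\mathcal D$ is a chain. The dual space $S_{\mathcal D}$ is the set of ultrafilters $x$ with $\mathrm{dist}_{\mathcal D}(x,\phi_s)<\infty$ for all $s\in S$, with the metric $\mathrm{dist}_{\mathcal D}$. Suppose that $\mathcal D$ is $0$-separated, that is, if $h_1\neq h_2$ and $\{h_1,h_2\}\in\mathcal D$, then every $c\in\mathcal D$ all of whose members cross both $h_1$ and $h_2$ is empty. Suppose also that $\mathcal D$ is $m$-gluable for some $m\in\mathbf N$, that is, whenever $c_1,c_2\in\mathcal D$ are such that $c_1\cup c_2$ is a chain with halfspaces labelled so that $h^-\subsetneq k^-$ for all $h\in c_1$, $k\in c_2$, there is $d\subset c_1\cup c_2$ with $|d|\le m$ and $(c_1\cup c_2)\setminus d\in\mathcal D$. Then $S_{\mathcal D}$ is a quasitree, that is, it is quasi-isometric to a simplicial tree. -/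

import Mathlib

universe u

/-- A set of walls on `S`: a set of bipartitions `h = {h⁺, h⁻}` of `S`, each of them the
two-element set of its halfspaces. (Empty halfspaces are not excluded.) -/
structure WallSpace (S : Type u) where
  walls : Set (Set (Set S))
  bipartition : ∀ h ∈ walls, ∃ A : Set S, h = {A, Aᶜ}

namespace WallSpace

variable {S : Type u} (W : WallSpace S)

/-- The walls, as a type. -/
abbrev Wall : Type u := {h : Set (Set S) // h ∈ W.walls}

variable {W}

/-- `A` is one of the two halfspaces of the wall `h`. -/
def IsHalfspace (A : Set S) (h : W.Wall) : Prop := A ∈ h.1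

/-- Two walls cross if all four quarterspaces are non-empty. -/
def Cross (h k : W.Wall) : Prop :=
  ∀ A B : Set S, IsHalfspace A h → IsHalfspace B k → (A ∩ B).Nonempty

/-- The choice `o` of halfspaces `h⁻ = o h` for `h ∈ c` exhibits `c` as a chain: the halfspaces are
nested, and only finitely many walls of `c` lie between any two. The last condition says that
`c` can be listed as a sequence (finite, or infinite in one or both directions), in which
then every wall separates its predecessor from its successor. -/
structure OrientsChain (o : W.Wall → Set S) (c : Set W.Wall) : Prop where
  isHalfspace : ∀ h ∈ c, IsHalfspace (o h) h
  nested : ∀ h ∈ c, ∀ k ∈ c, o h ⊆ o k ∨ o k ⊆ o h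
  finite_between : ∀ h ∈ c, ∀ k ∈ c, {l | l ∈ c ∧ o h ⊆ o l ∧ o l ⊆ o k}.Finite

/-- A set of walls that forms a chain. -/
def IsWallChain (c : Set W.Wall) : Prop := ∃ o : W.Wall → Set S, OrientsChain o c

variable (W)

/-- An ultrafilter on the set of walls: a choice of a halfspace of each wall such that, if the
chosen halfspace of `h` is contained in a halfspace `B` of `k`, then `B` is chosen for `k`. -/
@[ext] structure WallUltrafilter where
  choice : W.Wall → Set S
  isHalfspace : ∀ h, IsHalfspace (choice h) h
  upward : ∀ (h k : W.Wall) (B : Set S), IsHalfspace B k → choice h ⊆ B → choice k = B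

variable {W}

theorem halfspace_eq_of_mem {h : W.Wall} {A B : Set S} {s : S} (hA : IsHalfspace A h)
    (hB : IsHalfspace B h) (sA : s ∈ A) (sB : s ∈ B) : A = B := by
  obtain ⟨C, hC⟩ := W.bipartition h.1 h.2
  simp only [IsHalfspace, hC, Set.mem_insert_iff, Set.mem_singleton_iff] at hA hB
  rcases hA with rfl | rfl <;> rcases hB with rfl | rfl <;> simp_all

theorem exists_halfspace_mem (h : W.Wall) (s : S) : ∃ A, IsHalfspace A h ∧ s ∈ A := by
  obtain ⟨C, hC⟩ := W.bipartition h.1 h.2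
  by_cases hs : s ∈ C
  · exact ⟨C, by simp [IsHalfspace, hC], hs⟩
  · exact ⟨Cᶜ, by simp [IsHalfspace, hC], hs⟩

variable (W)

/-- The ultrafilter `φ_s` of a point `s`: it chooses the halfspace of each wall that contains `s`. -/
noncomputable def pointUltrafilter (s : S) : W.WallUltrafilter where
  choice h := (exists_halfspace_mem h s).choose
  isHalfspace h := (exists_halfspace_mem h s).choose_spec.1
  upward h k _ hB hsub := halfspace_eq_of_mem (exists_halfspace_mem k s).choose_spec.1 hB
    (exists_halfspace_mem k s).choose_spec.2 (hsub (exists_halfspace_mem h s).choose_spec.2)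

theorem mem_pointUltrafilter (s : S) (h : W.Wall) : s ∈ (W.pointUltrafilter s).choice h :=
  (exists_halfspace_mem h s).choose_spec.2

variable {W}

/-- The set `c` of walls separates the ultrafilters `x` and `y`. -/
def Separates (c : Set W.Wall) (x y : W.WallUltrafilter) : Prop :=
  ∀ h ∈ c, x.choice h ≠ y.choice h

/-- `dist_𝒟(x, y) = sup {|c| : c ∈ 𝒟 separates x from y}`, with values in `ℕ ∪ {∞}`. -/
noncomputable def sepDist (𝒟 : Set (Set W.Wall)) (x y : W.WallUltrafilter) : ℕ∞ :=
  sSup {n : ℕ∞ | ∃ c ∈ 𝒟, Separates c x y ∧ n = c.encard}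

variable (W)

/-- A dualisable system on the set with walls `(S, W)`. -/
structure DualisableSystem where
  sets : Set (Set W.Wall)
  subset_mem : ∀ c ∈ sets, ∀ c' : Set W.Wall, c' ⊆ c → c' ∈ sets
  singleton_mem : ∀ h : W.Wall, {h} ∈ sets
  finite_sepDist : ∀ s t : S, sepDist sets (W.pointUltrafilter s) (W.pointUltrafilter t) < ⊤

variable {W}

theorem encard_le_sepDist {𝒟 : Set (Set W.Wall)} {x y : W.WallUltrafilter} {c : Set W.Wall}
    (hc : c ∈ 𝒟) (h : Separates c x y) : c.encard ≤ sepDist 𝒟 x y :=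
  le_sSup ⟨c, hc, h, rfl⟩

theorem sepDist_self (𝒟 : Set (Set W.Wall)) (x : W.WallUltrafilter) : sepDist 𝒟 x x = 0 := by
  refine le_antisymm (sSup_le ?_) bot_le
  rintro _ ⟨c, -, hs, rfl⟩
  have : c = ∅ := Set.eq_empty_of_forall_notMem fun h hh => hs h hh rfl
  simp [this]

theorem sepDist_comm (𝒟 : Set (Set W.Wall)) (x y : W.WallUltrafilter) :
    sepDist 𝒟 x y = sepDist 𝒟 y x := by
  have : ∀ c : Set W.Wall, Separates c x y ↔ Separates c y x := fun c =>
    ⟨fun h k hk => (h k hk).symm, fun h k hk => (h k hk).symm⟩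
  simp only [sepDist, this]

namespace DualisableSystem

variable (D : W.DualisableSystem)

theorem sepDist_triangle (x y z : W.WallUltrafilter) :
    sepDist D.sets x z ≤ sepDist D.sets x y + sepDist D.sets y z := by
  refine sSup_le ?_
  rintro _ ⟨c, hc, hs, rfl⟩
  let a : Set W.Wall := {h | h ∈ c ∧ x.choice h ≠ y.choice h}
  let b : Set W.Wall := {h | h ∈ c ∧ y.choice h ≠ z.choice h}
  have ha : a.encard ≤ sepDist D.sets x y :=
    encard_le_sepDist (D.subset_mem c hc a fun h hh => hh.1) fun h hh => hh.2
  have hb : b.encard ≤ sepDist D.sets y z :=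
    encard_le_sepDist (D.subset_mem c hc b fun h hh => hh.1) fun h hh => hh.2
  have hab : c ⊆ a ∪ b := by
    intro h hh
    by_cases hxy : x.choice h = y.choice h
    · exact Or.inr ⟨hh, fun hyz => hs h hh (hxy.trans hyz)⟩
    · exact Or.inl ⟨hh, hxy⟩
  calc c.encard ≤ (a ∪ b).encard := Set.encard_le_encard hab
    _ ≤ a.encard + b.encard := Set.encard_union_le a b
    _ ≤ _ := add_le_add ha hb

theorem eq_of_sepDist_eq_zero {x y : W.WallUltrafilter} (h : sepDist D.sets x y = 0) : x = y := by
  ext1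
  funext k
  by_contra hk
  have := encard_le_sepDist (D.singleton_mem k) (x := x) (y := y) (by
    rintro l rfl
    exact hk)
  rw [h, Set.encard_singleton] at this
  simp at this

/-- The dual space: the ultrafilters at finite distance from all points of `S`. -/
def Dual : Type u :=
  {x : W.WallUltrafilter // ∀ s : S, sepDist D.sets x (W.pointUltrafilter s) < ⊤}

theorem sepDist_lt_top (x y : D.Dual) : sepDist D.sets x.1 y.1 < ⊤ := by
  rcases isEmpty_or_nonempty S with hS | ⟨⟨s⟩⟩
  · have : x.1 = y.1 := by
      ext1
      funext k
      exact Subsingleton.elim _ _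
    rw [this, sepDist_self]
    simp
  · refine lt_of_le_of_lt (D.sepDist_triangle x.1 (W.pointUltrafilter s) y.1) ?_
    rw [sepDist_comm _ _ y.1]
    exact WithTop.add_lt_top.2 ⟨x.2 s, y.2 s⟩

/-- The dual space with the metric `dist_𝒟`. -/
noncomputable instance : MetricSpace D.Dual where
  dist x y := ((sepDist D.sets x.1 y.1).toNat : ℝ)
  dist_self x := by simp [sepDist_self]
  dist_comm x y := by simp [sepDist_comm _ x.1 y.1]
  dist_triangle x y z := by
    have hxy := (D.sepDist_lt_top x y).ne
    have hyz := (D.sepDist_lt_top y z).ne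
    have := ENat.toNat_le_toNat (D.sepDist_triangle x.1 y.1 z.1) (by simp [hxy, hyz])
    rw [ENat.toNat_add hxy hyz] at this
    exact_mod_cast this
  eq_of_dist_eq_zero {x y} h := by
    apply Subtype.ext
    apply D.eq_of_sepDist_eq_zero
    have h' : (sepDist D.sets x.1 y.1).toNat = 0 := by exact_mod_cast h
    rw [← ENat.natCast_toNat (D.sepDist_lt_top x y).ne, h']
    rfl

/-- Every element of the system is a chain. -/
def IsOfChains : Prop := ∀ c ∈ D.sets, IsWallChain c

/-- `m`-gluability. In terms of the halfspaces `h⁻ = o h`, the condition `c₁ ⊂ c₂⁻` says that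
all of `c₁` comes before all of `c₂` in the chain `c₁ ∪ c₂`. -/
def IsGluable (m : ℕ) : Prop :=
  ∀ c₁ ∈ D.sets, ∀ c₂ ∈ D.sets, ∀ o : W.Wall → Set S, OrientsChain o (c₁ ∪ c₂) →
    (∀ h ∈ c₁, ∀ k ∈ c₂, o h ⊂ o k) →
    ∃ d : Set W.Wall, d ⊆ c₁ ∪ c₂ ∧ d.encard ≤ m ∧ (c₁ ∪ c₂) \ d ∈ D.sets

/-- `L`-separation: for distinct walls `h₁`, `h₂` with `{h₁, h₂}` in the system, an element of the
system all of whose walls cross both `h₁` and `h₂` has cardinality at most `L`. -/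
def IsSeparated (L : ℕ) : Prop :=
  ∀ h₁ h₂ : W.Wall, h₁ ≠ h₂ → {h₁, h₂} ∈ D.sets → ∀ c ∈ D.sets,
    (∀ k ∈ c, Cross k h₁ ∧ Cross k h₂) → c.encard ≤ L

end DualisableSystem

end WallSpace

/-- A metric space is a quasitree if it is quasi-isometric to a simplicial tree. The tree is
given by its vertices with the path metric, which are coarsely dense in the tree. -/
def IsQuasitree (X : Type u) [MetricSpace X] : Prop :=
  ∃ (V : Type u) (T : SimpleGraph V) (f : X → V) (K C : ℝ), T.IsTree ∧ 1 ≤ K ∧ 0 ≤ C ∧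
    (∀ x y : X, K⁻¹ * dist x y - C ≤ (T.dist (f x) (f y) : ℝ) ∧
      (T.dist (f x) (f y) : ℝ) ≤ K * dist x y + C) ∧
    ∀ v : V, ∃ x : X, (T.dist (f x) v : ℝ) ≤ C

/-! Fix a base point `o`. The largest `n` with `CommonChain o n x y` serves as the Gromov product of
`x` and `y`: up to an additive constant, `d(x, y) = d(o, x) + d(o, y) - 2n`
(`CommonChain.natDist_add_le`, `natDist_add_natDist_le`). Having a common chain of length `n` is not
a transitive relation, but a sequence of any number of steps loses only `m + 1` walls in all
(`CommonChain.of_transGen`). Since the loss does not depend on the number of steps, the relations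
may be replaced by their transitive closures.

These closures are nested partial equivalence relations, and their classes form a rooted tree in
which the same distance formula is exact (`dist_vertex_le`, `le_dist_vertex`). Sending `x` to its
class at level `d(o, x)` therefore preserves distances up to an additive constant;
`exists_commonChain_natDist_le` makes the image coarsely dense.

The estimates on walls rest on three facts: by `0`-separation a wall crosses at most one wall of a
chain (`IsSeparated.exists_subset_not_cross`), suitable walls that do not cross are nested
(`subset_of_not_cross`), and consecutive chains can be glued at a cost of `m` walls, the result
being no longer than the distance (`IsGluable.card_add_card_le`). -/

/-! ### The rooted tree of a nested sequence of relations -/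

/-- A decreasing sequence of partial equivalence relations, the first of which is total. -/
structure NestedRelations (X : Type u) where
  rel : ℕ → X → X → Prop
  symm : ∀ {n x y}, rel n x y → rel n y x
  trans : ∀ {n x y z}, rel n x y → rel n y z → rel n x z
  anti : ∀ {n k x y}, n ≤ k → rel k x y → rel n x y
  total : ∀ x y, rel 0 x y

namespace NestedRelations

variable {X : Type u} (E : NestedRelations X)

/-- The classes of the relations, each with its level. -/
def Vertex : Type u := {p : ℕ × Set X // ∃ x, E.rel p.1 x x ∧ p.2 = {y | E.rel p.1 x y}}

variable {E}

/-- The class of `x` at level `n`. -/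
def vertex {n : ℕ} {x : X} (h : E.rel n x x) : E.Vertex := ⟨(n, {y | E.rel n x y}), x, h, rfl⟩

namespace Vertex

/-- The level of a class. -/
def level (v : E.Vertex) : ℕ := v.1.1

/-- The points of a class. -/
def points (v : E.Vertex) : Set X := v.1.2

theorem ext {v w : E.Vertex} (h : v.level = w.level) (h' : v.points = w.points) : v = w :=
  Subtype.ext (Prod.ext h h')

theorem nonempty (v : E.Vertex) : v.points.Nonempty := by
  obtain ⟨⟨n, A⟩, x, hx, hA⟩ := v
  simp only at hx hA
  subst hA
  exact ⟨x, hx⟩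

theorem mem_iff {v : E.Vertex} {x : X} (hx : x ∈ v.points) {y : X} :
    y ∈ v.points ↔ E.rel v.level x y := by
  obtain ⟨⟨n, A⟩, z, hz, hA⟩ := v
  simp only at hz hA
  subst hA
  exact ⟨fun h => E.trans (E.symm hx) h, fun h => E.trans hx h⟩

theorem rel_self {v : E.Vertex} {x : X} (hx : x ∈ v.points) : E.rel v.level x x :=
  (mem_iff hx).1 hx

theorem eq_vertex {v : E.Vertex} {x : X} (hx : x ∈ v.points) : v = vertex (rel_self hx) :=
  ext rfl (Set.ext fun _ => mem_iff hx)

/-- The class `w` lies in the class of `x` at level `n`. -/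
def Below (n : ℕ) (x : X) (w : E.Vertex) : Prop := n ≤ w.level ∧ ∀ y ∈ w.points, E.rel n x y

theorem below_of_mem {n : ℕ} {x y : X} {w : E.Vertex} (hn : n ≤ w.level) (hy : y ∈ w.points)
    (h : E.rel n x y) : Below n x w :=
  ⟨hn, fun _ hz => E.trans h (E.anti hn ((mem_iff hy).1 hz))⟩

end Vertex

open Vertex

variable (E)

/-- The graph that joins each class to the class of the next level that contains it. -/
def tree : SimpleGraph E.Vertex where
  Adj v w := (w.level = v.level + 1 ∧ w.points ⊆ v.points) ∨
    (v.level = w.level + 1 ∧ v.points ⊆ w.points)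
  symm := ⟨fun _ _ h => h.symm⟩
  loopless := ⟨fun v h => by omega⟩

variable {E}

/-- Among the edges of the tree, only the one above the class of `x` at level `n` leaves the
subtree of that class. -/
theorem below_iff_of_child {n : ℕ} {x : X} {v w : E.Vertex} (hl : w.level = v.level + 1)
    (hs : w.points ⊆ v.points) (hne : ¬ (w.level = n ∧ x ∈ w.points)) :
    Below n x v ↔ Below n x w := by
  obtain ⟨y, hy⟩ := w.nonempty
  constructor
  · exact fun h => ⟨by have := h.1; omega, fun z hz => h.2 z (hs hz)⟩
  · intro h
    have hxy := h.2 y hy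
    refine below_of_mem ?_ (hs hy) hxy
    by_contra hlt
    have hwn : w.level = n := by have := h.1; omega
    exact hne ⟨hwn, (mem_iff hy).2 (by rw [hwn]; exact E.symm hxy)⟩

theorem reachable_vertex {n k : ℕ} {x : X} (hk : E.rel (n + k) x x) (hn : E.rel n x x) :
    ∃ p : E.tree.Walk (vertex hk) (vertex hn), p.length = k := by
  induction k with
  | zero => exact ⟨.nil, rfl⟩
  | succ k ih =>
    have hk' : E.rel (n + k) x x := E.anti (by omega) hk
    obtain ⟨p, hp⟩ := ih hk'
    have hadj : E.tree.Adj (vertex hk) (vertex hk') :=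
      Or.inr ⟨rfl, fun y hy => E.anti (by omega : n + k ≤ n + (k + 1)) hy⟩
    exact ⟨.cons hadj p, by simp [hp]⟩

theorem vertex_eq_vertex {n : ℕ} {x y : X} (h : E.rel n x y) (hx : E.rel n x x)
    (hy : E.rel n y y) : vertex hx = vertex hy :=
  eq_vertex (v := vertex hx) (x := y) h

/-- Every class climbs to a class at level `0`, and `total` leaves only one of these. -/
theorem tree_connected [Nonempty X] : E.tree.Connected := by
  obtain ⟨o⟩ := ‹Nonempty X›
  have key : ∀ v : E.Vertex, E.tree.Reachable v (vertex (E.total o o)) := by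
    intro v
    obtain ⟨x, hx⟩ := v.nonempty
    obtain ⟨p, -⟩ := reachable_vertex (n := 0) (k := v.level) (x := x)
      (by simpa using rel_self hx) (E.total x x)
    rw [← vertex_eq_vertex (E.total x o) (E.total x x) (E.total o o)]
    rw [eq_vertex hx]
    have : vertex (rel_self hx) = vertex (E := E) (n := 0 + v.level) (x := x)
        (by simpa using rel_self hx) := by
      apply Vertex.ext <;> simp [vertex, Vertex.level, Vertex.points]
    rw [this]
    exact ⟨p⟩
  have : Nonempty E.Vertex := ⟨vertex (E.total o o)⟩
  exact ⟨fun v w => (key v).trans (key w).symm⟩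

/-- Every edge is a bridge: once the edge above `w` is deleted, lying below the class `w` is
constant along walks, yet it holds for `w` and fails for its parent. -/
theorem tree_isAcyclic : E.tree.IsAcyclic := by
  rw [SimpleGraph.isAcyclic_iff_forall_adj_isBridge]
  have key : ∀ v w : E.Vertex, w.level = v.level + 1 → w.points ⊆ v.points →
      ¬ (E.tree \ SimpleGraph.fromEdgeSet {s(v, w)}).Reachable v w := by
    rintro v w hl hs ⟨p⟩
    obtain ⟨x, hx⟩ := w.nonempty
    have hstep : ∀ a b : E.Vertex, (E.tree \ SimpleGraph.fromEdgeSet {s(v, w)}).Adj a b →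
        b.level = a.level + 1 → b.points ⊆ a.points → (Below w.level x a ↔ Below w.level x b) := by
      intro a b hab hl' hs'
      refine below_iff_of_child hl' hs' ?_
      rintro ⟨hbw, hxb⟩
      have h₁ : b = w := Vertex.ext hbw <| Set.ext fun y => by
        rw [mem_iff hxb, mem_iff hx, hbw]
      subst h₁
      have h₂ : a = v := Vertex.ext (by omega) <| Set.ext fun y => by
        rw [mem_iff (hs' hx), mem_iff (hs hx), show a.level = v.level by omega]
      subst h₂
      simp [SimpleGraph.sdiff_adj, hab.ne] at hab
    have hinv : ∀ a b : E.Vertex, (E.tree \ SimpleGraph.fromEdgeSet {s(v, w)}).Walk a b →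
        (Below w.level x a ↔ Below w.level x b) := by
      intro a b q
      induction q with
      | nil => rfl
      | cons hab _ ih =>
        rw [← ih]
        rcases hab.1 with ⟨h, h'⟩ | ⟨h, h'⟩
        · exact hstep _ _ hab h h'
        · exact (hstep _ _ hab.symm h h').symm
    have hw : Below w.level x w := below_of_mem le_rfl hx (rel_self hx)
    have := ((hinv v w p).2 hw).1
    omega
  intro v w hvw
  rw [SimpleGraph.isBridge_iff]
  rcases hvw with ⟨h, h'⟩ | ⟨h, h'⟩
  · exact key v w h h'
  · rw [Sym2.eq_swap]
    exact fun hr => key w v h h' hr.symm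

theorem tree_isTree [Nonempty X] : E.tree.IsTree := ⟨tree_connected, tree_isAcyclic⟩

/-- Both vertices climb to level `n`, where the classes of `x` and `y` coincide. -/
theorem dist_vertex_le [Nonempty X] {a b n : ℕ} {x y : X} (hx : E.rel a x x) (hy : E.rel b y y)
    (hxy : E.rel n x y) (ha : n ≤ a) (hb : n ≤ b) :
    E.tree.dist (vertex hx) (vertex hy) + 2 * n ≤ a + b := by
  obtain ⟨k, rfl⟩ := Nat.exists_eq_add_of_le ha
  obtain ⟨l, rfl⟩ := Nat.exists_eq_add_of_le hb
  obtain ⟨p, hp⟩ := reachable_vertex hx (E.anti ha hx)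
  obtain ⟨q, hq⟩ := reachable_vertex hy (E.anti hb hy)
  have h₁ := SimpleGraph.dist_le p
  have h₂ := SimpleGraph.dist_le q.reverse
  rw [hp] at h₁
  rw [SimpleGraph.Walk.length_reverse, hq] at h₂
  have h₃ := (tree_connected (E := E)).dist_triangle (u := vertex hx)
    (v := vertex (E.anti ha hx)) (w := vertex hy)
  rw [vertex_eq_vertex hxy (E.anti ha hx) (E.anti hb hy)] at h₁ h₃
  omega

open Classical in
/-- The signed distance from the class of `x` at level `n`. -/
noncomputable def height (n : ℕ) (x : X) (v : E.Vertex) : ℤ :=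
  if Below (n + 1) x v then (v.level : ℤ) - n else n - v.level

theorem abs_height_sub_le_of_child {n : ℕ} {x : X} {v w : E.Vertex} (hl : w.level = v.level + 1)
    (hs : w.points ⊆ v.points) : |height n x v - height n x w| ≤ 1 := by
  by_cases hne : w.level = n + 1 ∧ x ∈ w.points
  · have hw : Below (n + 1) x w :=
      below_of_mem hne.1.ge hne.2 (by rw [← hne.1]; exact rel_self hne.2)
    have hv : ¬ Below (n + 1) x v := fun h => by have := h.1; omega
    simp only [height, hw, hv, if_true, if_false]
    rw [abs_le]; omega
  · have hiff := below_iff_of_child hl hs hne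
    by_cases hv : Below (n + 1) x v
    · simp only [height, hv, hiff.1 hv, if_true]
      rw [abs_le]; omega
    · simp only [height, hv, mt hiff.2 hv, if_false]
      rw [abs_le]; omega

theorem height_sub_le_dist [Nonempty X] (n : ℕ) (x : X) (v w : E.Vertex) :
    height n x v - height n x w ≤ E.tree.dist v w := by
  have key : ∀ a b : E.Vertex, ∀ p : E.tree.Walk a b,
      height n x a - height n x b ≤ p.length := by
    intro a b p
    induction p with
    | nil => simp
    | cons hab p ih =>
      rename_i a b c
      have : |height n x a - height n x b| ≤ 1 := by
        rcases hab with ⟨h, h'⟩ | ⟨h, h'⟩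
        · exact abs_height_sub_le_of_child h h'
        · rw [abs_sub_comm]; exact abs_height_sub_le_of_child h h'
      rw [abs_le] at this
      simp only [SimpleGraph.Walk.length_cons]
      push_cast
      omega
  obtain ⟨p, hp⟩ := (tree_connected (E := E)).exists_walk_length_eq_dist v w
  rw [← hp]
  exact key v w p

/-- The function `height n x` changes by at most one along an edge; it is `a - n` at one vertex and
`n - b` at the other. -/
theorem le_dist_vertex [Nonempty X] {a b n : ℕ} {x y : X} (hx : E.rel a x x) (hy : E.rel b y y)
    (hxy : ¬ E.rel (n + 1) x y) (ha : n ≤ a) :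
    a + b ≤ E.tree.dist (vertex hx) (vertex hy) + 2 * n := by
  have h := height_sub_le_dist n x (vertex hx) (vertex hy)
  have h₁ : height n x (vertex hx) = (a : ℤ) - n := by
    by_cases hB : Below (n + 1) x (vertex hx)
    · simp only [height, hB, if_true]; rfl
    -- At level `n` itself the vertex is not below level `n + 1`, but there both branches of
    -- `height` vanish.
    · have : a = n := by
        by_contra hne
        have hna : n + 1 ≤ a := by omega
        exact hB (below_of_mem hna hx (E.anti hna hx))
      simp only [height, hB, if_false]
      simp [Vertex.level, vertex, this]
  have h₂ : height n x (vertex hy) = (n : ℤ) - b := by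
    have hB : ¬ Below (n + 1) x (vertex hy) := fun hB => hxy (hB.2 y hy)
    simp only [height, hB, if_false]; rfl
  rw [h₁, h₂] at h
  omega

end NestedRelations

/-! ### Halfspaces, crossing walls and ultrafilters -/

namespace WallSpace

variable {S : Type u} {W : WallSpace S}

theorem IsHalfspace.compl {A : Set S} {h : W.Wall} (hA : IsHalfspace A h) : IsHalfspace Aᶜ h := by
  obtain ⟨C, hC⟩ := W.bipartition h.1 h.2
  simp only [IsHalfspace, hC, Set.mem_insert_iff, Set.mem_singleton_iff] at hA ⊢
  rcases hA with rfl | rfl <;> simp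

theorem IsHalfspace.eq_or_eq_compl {A B : Set S} {h : W.Wall} (hA : IsHalfspace A h)
    (hB : IsHalfspace B h) : B = A ∨ B = Aᶜ := by
  obtain ⟨C, hC⟩ := W.bipartition h.1 h.2
  simp only [IsHalfspace, hC, Set.mem_insert_iff, Set.mem_singleton_iff] at hA hB
  rcases hA with rfl | rfl <;> rcases hB with rfl | rfl <;> simp

theorem IsHalfspace.wall_eq {A : Set S} {h k : W.Wall} (hh : IsHalfspace A h)
    (hk : IsHalfspace A k) : h = k := by
  have key : ∀ l : W.Wall, IsHalfspace A l → l.1 = {A, Aᶜ} := fun l hl => by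
    ext B
    simp only [Set.mem_insert_iff, Set.mem_singleton_iff]
    refine ⟨fun hB => hl.eq_or_eq_compl hB, ?_⟩
    rintro (rfl | rfl)
    exacts [hl, hl.compl]
  exact Subtype.ext ((key h hh).trans (key k hk).symm)

theorem Cross.symm {h k : W.Wall} (hc : Cross h k) : Cross k h := fun A B hA hB => by
  rw [Set.inter_comm]; exact hc B A hB hA

theorem cross_of_nonempty {h k : W.Wall} {A B : Set S} (hA : IsHalfspace A h)
    (hB : IsHalfspace B k) (h₁ : (A ∩ B).Nonempty) (h₂ : (A ∩ Bᶜ).Nonempty)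
    (h₃ : (Aᶜ ∩ B).Nonempty) (h₄ : (Aᶜ ∩ Bᶜ).Nonempty) : Cross h k := by
  intro A' B' hA' hB'
  rcases hA.eq_or_eq_compl hA' with rfl | rfl <;> rcases hB.eq_or_eq_compl hB' with rfl | rfl <;>
    assumption

theorem Separates.symm {c : Set W.Wall} {x y : W.WallUltrafilter} (h : Separates c x y) :
    Separates c y x := fun k hk => (h k hk).symm

theorem Separates.mono {c d : Set W.Wall} {x y : W.WallUltrafilter} (h : Separates c x y)
    (hd : d ⊆ c) : Separates d x y := fun k hk => h k (hd hk)

namespace WallUltrafilter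

variable {o x y : W.WallUltrafilter} {h k : W.Wall}

theorem choice_eq_compl (hne : x.choice h ≠ y.choice h) : y.choice h = (x.choice h)ᶜ :=
  ((x.isHalfspace h).eq_or_eq_compl (y.isHalfspace h)).resolve_left hne.symm

theorem wall_eq (he : x.choice h = x.choice k) : h = k :=
  (x.isHalfspace h).wall_eq (he ▸ x.isHalfspace k)

/-- The halfspaces chosen by an ultrafilter for the walls of a chain that separates it from another
ultrafilter are nested. -/
theorem subset_or_subset {c : Set W.Wall} (hc : IsWallChain c) (hs : Separates c x y) (hh : h ∈ c)
    (hk : k ∈ c) : x.choice h ⊆ x.choice k ∨ x.choice k ⊆ x.choice h := by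
  obtain ⟨ω, hω⟩ := hc
  have key : ∀ a ∈ c, ∀ b ∈ c, ω a ⊆ ω b →
      x.choice a ⊆ x.choice b ∨ x.choice b ⊆ x.choice a := by
    intro a ha b hb hab
    have hae := (hω.isHalfspace a ha).eq_or_eq_compl (x.isHalfspace a)
    have hbe := (hω.isHalfspace b hb).eq_or_eq_compl (x.isHalfspace b)
    rcases hae with ha' | ha'
    · rw [x.upward a b (ω b) (hω.isHalfspace b hb) (ha' ▸ hab), ha']
      exact Or.inl hab
    · rcases hbe with hb' | hb'
      -- Here `x` chooses `ω b` but not `ω a`. Then `y` chooses `ω a`, hence also `ω b`, so `b`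
      -- would not separate `x` from `y`.
      · have hy : y.choice a = ω a := by
          rw [choice_eq_compl (hs a ha), ha', compl_compl]
        exact absurd (hb'.trans (y.upward a b (ω b) (hω.isHalfspace b hb) (hy ▸ hab)).symm)
          (hs b hb)
      · rw [ha', hb']
        exact Or.inr (Set.compl_subset_compl.2 hab)
  rcases hω.nested h hh k hk with hhk | hhk
  · exact key h hh k hk hhk
  · exact (key k hk h hh hhk).symm

variable [Nonempty S]

/-- This is where a point of `S` is needed: over an empty `S` the two halfspaces of a wall coincide.
-/
theorem compl_ne (A : Set S) : Aᶜ ≠ A := fun h => by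
  obtain ⟨s⟩ := ‹Nonempty S›
  have : s ∈ Aᶜ ↔ s ∈ A := by rw [h]
  simp at this

theorem inter_nonempty (x : W.WallUltrafilter) (h k : W.Wall) :
    (x.choice h ∩ x.choice k).Nonempty := by
  rw [← Set.not_disjoint_iff_nonempty_inter]
  intro hd
  have := x.upward h k _ (x.isHalfspace k).compl hd.subset_compl_right
  exact compl_ne _ this.symm

theorem ne_of_subset (hs : x.choice h ⊆ x.choice k) (hne : x.choice k ≠ y.choice k) :
    x.choice h ≠ y.choice h := by
  have h₁ := y.upward k h _ (x.isHalfspace h).compl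
    (by rw [choice_eq_compl hne]; exact Set.compl_subset_compl.2 hs)
  rw [h₁]
  exact (compl_ne _).symm

/-- Three ultrafilters in distinct quarterspaces of two walls that do not cross. -/
theorem subset_of_not_cross (hx : o.choice h ≠ x.choice h) (hy : o.choice h ≠ y.choice h)
    (hky : o.choice k = y.choice k) (hkx : o.choice k ≠ x.choice k) (hc : ¬ Cross h k) :
    o.choice h ⊆ o.choice k := by
  by_contra hsub
  -- Each of `o`, `y`, `x` witnesses one nonempty quarterspace; the fourth comes from the failure of
  -- the inclusion.
  refine hc (cross_of_nonempty (o.isHalfspace h) (o.isHalfspace k) (o.inter_nonempty h k) ?_ ?_ ?_)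
  · obtain ⟨s, hs, hs'⟩ := Set.not_subset.1 hsub
    exact ⟨s, hs, hs'⟩
  · have := y.inter_nonempty h k
    rwa [choice_eq_compl hy, ← hky] at this
  · have := x.inter_nonempty h k
    rwa [choice_eq_compl hx, choice_eq_compl hkx] at this

open Classical in
/-- The projection of `o` to the halfspace of `t` that is not chosen by `o`, where `x` is an
ultrafilter that chooses this halfspace. -/
noncomputable def gate (o x : W.WallUltrafilter) (t : W.Wall) (ht : o.choice t ≠ x.choice t) :
    W.WallUltrafilter where
  choice h := if o.choice h ⊆ o.choice t then (o.choice h)ᶜ else o.choice h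
  isHalfspace h := by
    split_ifs
    exacts [(o.isHalfspace h).compl, o.isHalfspace h]
  upward h k B hB hsub := by
    have hxt := choice_eq_compl ht
    by_cases hh : o.choice h ⊆ o.choice t
    · rw [if_pos hh] at hsub
      have htB : (o.choice t)ᶜ ⊆ B := (Set.compl_subset_compl.2 hh).trans hsub
      rcases (o.isHalfspace k).eq_or_eq_compl hB with rfl | rfl
      · rw [if_neg]
        intro hk
        -- If `k` were flipped, `x` would have to leave `o.choice k`, since it leaves the larger
        -- `o.choice t`; but it must also choose `o.choice k`, which contains the halfspace it
        -- chooses for `t`.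
        have hxk := x.upward t k _ hB (hxt ▸ htB)
        exact ne_of_subset hk ht hxk.symm
      · rw [if_pos (Set.compl_subset_compl.1 htB)]
    · rw [if_neg hh] at hsub
      have hoB := o.upward h k B hB hsub
      rw [if_neg, hoB]
      exact fun hk => hh (hsub.trans (hoB ▸ hk))

theorem choice_ne_gate_iff (ht : o.choice t ≠ x.choice t) :
    o.choice h ≠ (gate o x t ht).choice h ↔ o.choice h ⊆ o.choice t := by
  simp only [gate]
  split_ifs with hh
  · simp [hh, (compl_ne (o.choice h)).symm]
  · simp [hh]

end WallUltrafilter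

/-! ### Finite chains and gluing -/

namespace DualisableSystem

open WallUltrafilter

variable {D : W.DualisableSystem}

/-- The distance in the dual space, as a natural number. -/
noncomputable def natDist (x y : D.Dual) : ℕ := (sepDist D.sets x.1 y.1).toNat

theorem dist_eq_natDist (x y : D.Dual) : dist x y = natDist x y := rfl

theorem card_le_natDist {x y : D.Dual} {c : Finset W.Wall} (hc : ↑c ∈ D.sets)
    (hs : Separates ↑c x.1 y.1) : c.card ≤ natDist x y := by
  have h := encard_le_sepDist hc hs
  rw [Set.encard_coe_eq_coe_finsetCard, ← ENat.natCast_toNat (D.sepDist_lt_top x y).ne] at h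
  exact_mod_cast h

theorem empty_mem [Nonempty W.Wall] : ∅ ∈ D.sets :=
  D.subset_mem _ (D.singleton_mem (Classical.arbitrary _)) _ (Set.empty_subset _)

theorem mem_of_subset {c d : Finset W.Wall} (hc : ↑c ∈ D.sets) (h : d ⊆ c) : ↑d ∈ D.sets :=
  D.subset_mem _ hc _ (Finset.coe_subset.2 h)

/-- The supremum is finite, hence attained. These longest chains replace geodesics. -/
theorem exists_chain [Nonempty W.Wall] (x y : D.Dual) :
    ∃ c : Finset W.Wall, ↑c ∈ D.sets ∧ Separates ↑c x.1 y.1 ∧ c.card = natDist x y := by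
  have hlt := D.sepDist_lt_top x y
  have : Nonempty {n : ℕ∞ | ∃ c ∈ D.sets, Separates c x.1 y.1 ∧ n = c.encard} :=
    ⟨_, ∅, empty_mem, fun _ h => h.elim, rfl⟩
  obtain ⟨c, hc, hs, hn⟩ := ENat.sSup_mem_of_nonempty_of_lt_top hlt
  have hfin : c.Finite := by
    rw [← Set.encard_lt_top_iff, ← hn]; exact hlt
  refine ⟨hfin.toFinset, by simpa using hc, by simpa using hs, ?_⟩
  have : natDist x y = c.encard.toNat := congrArg ENat.toNat hn
  rw [this, hfin.encard_eq_coe_toFinset_card]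
  rfl

open Classical in
/-- Two chains of a gluable system, one after the other. -/
theorem IsGluable.card_add_card_le {m : ℕ} (hg : D.IsGluable m) (hch : D.IsOfChains) {x y : D.Dual}
    {c₁ c₂ : Finset W.Wall} (h₁ : ↑c₁ ∈ D.sets) (h₂ : ↑c₂ ∈ D.sets) (s₁ : Separates ↑c₁ x.1 y.1)
    (s₂ : Separates ↑c₂ x.1 y.1) (hsub : ∀ h ∈ c₁, ∀ k ∈ c₂, x.1.choice h ⊆ x.1.choice k)
    (hne : ∀ h ∈ c₁, h ∉ c₂) : c₁.card + c₂.card ≤ natDist x y + m := by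
  have hor : OrientsChain x.1.choice ((c₁ : Set W.Wall) ∪ c₂) := by
    refine ⟨fun h _ => x.1.isHalfspace h, ?_, fun h _ k _ => ?_⟩
    · rintro h (hh | hh) k (hk | hk)
      · exact subset_or_subset (hch _ h₁) s₁ hh hk
      · exact Or.inl (hsub h hh k hk)
      · exact Or.inr (hsub k hk h hh)
      · exact subset_or_subset (hch _ h₂) s₂ hh hk
    · exact ((c₁.finite_toSet).union c₂.finite_toSet).subset fun l hl => hl.1
  obtain ⟨d, hd, hdm, hdD⟩ := hg _ h₁ _ h₂ _ hor fun h hh k hk =>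
    (hsub h hh k hk).ssubset_of_ne fun he => hne h hh (wall_eq he ▸ hk)
  have hfin : d.Finite := ((c₁.finite_toSet).union c₂.finite_toSet).subset hd
  lift d to Finset W.Wall using hfin
  rw [Set.encard_coe_eq_coe_finsetCard] at hdm
  have hdm' : d.card ≤ m := by exact_mod_cast hdm
  have hle : ((c₁ ∪ c₂) \ d).card ≤ natDist x y := by
    refine card_le_natDist (by simpa using hdD) ?_
    intro h hh
    simp only [Finset.coe_sdiff, Finset.coe_union] at hh
    exact hh.1.elim (s₁ h) (s₂ h)
  have h₃ := Finset.le_card_sdiff d (c₁ ∪ c₂)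
  rw [Finset.card_union_of_disjoint (Finset.disjoint_left.2 hne)] at h₃
  omega

open Classical in
/-- A wall crosses at most one wall of a chain of a `0`-separated system. -/
theorem IsSeparated.exists_subset_not_cross (hs : D.IsSeparated 0) {c : Finset W.Wall}
    (hc : ↑c ∈ D.sets) (t : W.Wall) :
    ∃ c' ⊆ c, c.card ≤ c'.card + 1 ∧ ∀ k ∈ c', ¬ Cross t k := by
  refine ⟨c.filter fun k => ¬ Cross t k, Finset.filter_subset _ _, ?_,
    fun k hk => (Finset.mem_filter.1 hk).2⟩
  have h₁ : (c.filter fun k => Cross t k).card ≤ 1 := by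
    refine Finset.card_le_one.2 fun h hh k hk => ?_
    rw [Finset.mem_filter] at hh hk
    by_contra hne
    -- `0`-separation is applied to the one-wall chain `{t}`.
    have hle := hs h k hne (D.subset_mem _ hc _ (by
      rintro l (rfl | rfl)
      exacts [hh.1, hk.1])) {t} (D.singleton_mem t) (by
      rintro l rfl
      exact ⟨hh.2, hk.2⟩)
    simp at hle
  have h₂ := Finset.card_filter_add_card_filter_not (s := c) fun k => Cross t k
  omega

theorem IsOfChains.exists_greatest (hch : D.IsOfChains) {x y : D.Dual} {c : Finset W.Wall}
    (hc : ↑c ∈ D.sets) (hs : Separates ↑c x.1 y.1) (hne : c.Nonempty) :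
    ∃ t ∈ c, ∀ h ∈ c, x.1.choice h ⊆ x.1.choice t := by
  obtain ⟨t, ht, hmax⟩ := Finset.exists_maximalFor x.1.choice c hne
  exact ⟨t, ht, fun h hh => (subset_or_subset (hch _ hc) hs hh ht).elim id fun h' => hmax hh h'⟩

theorem IsOfChains.exists_least (hch : D.IsOfChains) {x y : D.Dual} {c : Finset W.Wall}
    (hc : ↑c ∈ D.sets) (hs : Separates ↑c x.1 y.1) (hne : c.Nonempty) :
    ∃ t ∈ c, ∀ h ∈ c, x.1.choice t ⊆ x.1.choice h := by
  obtain ⟨t, ht, hmin⟩ := Finset.exists_minimalFor x.1.choice c hne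
  exact ⟨t, ht, fun h hh => (subset_or_subset (hch _ hc) hs ht hh).elim id fun h' => hmin hh h'⟩

open Classical in
theorem IsOfChains.exists_initial (hch : D.IsOfChains) {x y : D.Dual} {c : Finset W.Wall}
    (hc : ↑c ∈ D.sets) (hs : Separates ↑c x.1 y.1) {n : ℕ} (hn : n ≤ c.card) :
    ∃ e ⊆ c, e.card = n ∧ ∀ h ∈ e, ∀ k ∈ c \ e, x.1.choice h ⊆ x.1.choice k := by
  induction n with
  | zero => exact ⟨∅, Finset.empty_subset c, rfl, by simp⟩
  | succ n ih =>
    obtain ⟨e, hec, hen, he⟩ := ih (by omega)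
    have hne : (c \ e).Nonempty := by
      rw [← Finset.card_pos]
      have := Finset.le_card_sdiff e c
      omega
    have hsub : c \ e ⊆ c := Finset.sdiff_subset
    obtain ⟨t, ht, hmin⟩ := hch.exists_least (mem_of_subset hc hsub)
      (hs.mono (Finset.coe_subset.2 hsub)) hne
    have hte := (Finset.mem_sdiff.1 ht).2
    refine ⟨insert t e, Finset.insert_subset (hsub ht) hec,
      by rw [Finset.card_insert_of_notMem hte, hen], fun h hh k hk => ?_⟩
    have hk' : k ∈ c \ e := by
      simp only [Finset.mem_sdiff, Finset.mem_insert, not_or] at hk ⊢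
      exact ⟨hk.1, hk.2.2⟩
    rcases Finset.mem_insert.1 hh with rfl | hh
    exacts [hmin k hk', he h hh k hk']

/-! ### Common chains as a Gromov product -/

/-- Some chain of `n` walls separates `o` from both `x` and `y`. -/
def CommonChain (o : D.Dual) (n : ℕ) (x y : D.Dual) : Prop :=
  ∃ c : Finset W.Wall, ↑c ∈ D.sets ∧ c.card = n ∧ Separates ↑c o.1 x.1 ∧ Separates ↑c o.1 y.1

variable {o x y z : D.Dual} {n k m : ℕ}

theorem CommonChain.symm (h : CommonChain o n x y) : CommonChain o n y x := by
  obtain ⟨c, hc, hn, hx, hy⟩ := h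
  exact ⟨c, hc, hn, hy, hx⟩

theorem CommonChain.anti (hnk : n ≤ k) (h : CommonChain o k x y) : CommonChain o n x y := by
  obtain ⟨c, hc, hk, hx, hy⟩ := h
  obtain ⟨d, hdc, hd⟩ := Finset.exists_subset_card_eq (hnk.trans hk.ge)
  exact ⟨d, mem_of_subset hc hdc, hd, hx.mono (Finset.coe_subset.2 hdc),
    hy.mono (Finset.coe_subset.2 hdc)⟩

theorem commonChain_zero [Nonempty W.Wall] : CommonChain o 0 x y :=
  ⟨∅, by simpa using empty_mem, rfl, by simp [Separates], by simp [Separates]⟩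

theorem CommonChain.le_natDist (h : CommonChain o n x y) : n ≤ natDist o x := by
  obtain ⟨c, hc, rfl, hx, -⟩ := h
  exact card_le_natDist hc hx

theorem commonChain_self_iff [Nonempty W.Wall] : CommonChain o n x x ↔ n ≤ natDist o x := by
  refine ⟨CommonChain.le_natDist, fun h => ?_⟩
  obtain ⟨c, hc, hs, hn⟩ := exists_chain o x
  exact CommonChain.anti h ⟨c, hc, hn, hs, hs⟩

variable [Nonempty S]

/-- Let `t` be the wall of `e` farthest from `o`. Apart from at most one wall that crosses `t`, all
of `c` lies beyond `t`, so it can be glued after `e`. -/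
theorem card_add_le_of_separates (hch : D.IsOfChains) (hg : D.IsGluable m)
    (hsep : D.IsSeparated 0) {e c : Finset W.Wall} (he : ↑e ∈ D.sets) (hc : ↑c ∈ D.sets)
    (hex : Separates ↑e o.1 x.1) (hey : Separates ↑e o.1 y.1) (hcx : Separates ↑c o.1 x.1)
    (hcy : ∀ k ∈ c, o.1.choice k = y.1.choice k) : e.card + c.card ≤ natDist o x + m + 1 := by
  rcases e.eq_empty_or_nonempty with rfl | hne
  · have := card_le_natDist hc hcx
    simp; omega
  obtain ⟨t, hte, ht⟩ := hch.exists_greatest he hex hne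
  obtain ⟨c', hc'c, hcard, hcross⟩ := hsep.exists_subset_not_cross hc t
  have hle := hg.card_add_card_le hch he (mem_of_subset hc hc'c) hex
    (hcx.mono (Finset.coe_subset.2 hc'c)) (fun h hh k hk => (ht h hh).trans
      (subset_of_not_cross (hex t hte) (hey t hte) (hcy k (hc'c hk)) (hcx k (hc'c hk))
        (hcross k hk)))
    (fun h hh hh' => hey h hh (hcy h (hc'c hh')))
  omega

-- Each wall of a longest chain from `x` to `y` separates `o` from exactly one of `x` and `y`. Both
-- halves of the chain continue the common chain, so `card_add_le_of_separates` bounds each of them.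
open Classical in
theorem CommonChain.natDist_add_le [Nonempty W.Wall] (hch : D.IsOfChains) (hg : D.IsGluable m)
    (hsep : D.IsSeparated 0) (h : CommonChain o n x y) :
    natDist x y + 2 * n ≤ natDist o x + natDist o y + 2 * m + 2 := by
  obtain ⟨e, he, rfl, hx, hy⟩ := h
  obtain ⟨c, hc, hs, hcard⟩ := exists_chain x y
  have h₁ := card_add_le_of_separates hch hg hsep he
    (mem_of_subset hc (Finset.filter_subset (fun k => o.1.choice k = y.1.choice k) c)) hx hy
    (fun k hk => by
      have hk := Finset.mem_filter.1 hk
      rw [hk.2]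
      exact (hs k hk.1).symm)
    (fun k hk => (Finset.mem_filter.1 hk).2)
  have h₂ := card_add_le_of_separates hch hg hsep he
    (mem_of_subset hc (Finset.filter_subset (fun k => ¬ o.1.choice k = y.1.choice k) c)) hy hx
    (fun k hk => (Finset.mem_filter.1 hk).2)
    (fun k hk => by
      have hk := Finset.mem_filter.1 hk
      by_contra hne
      exact hs k hk.1 ((choice_eq_compl hne).trans (choice_eq_compl hk.2).symm))
  have h₃ := Finset.card_filter_add_card_filter_not (s := c) fun k => o.1.choice k = y.1.choice k
  omega

-- In a longest chain from `o` to `x`, the walls that also separate `o` from `y` form a common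
-- chain, so there are at most `n`. The others, and likewise those on the side of `y`, separate `x`
-- from `y`, and they can be glued.
open Classical in
theorem natDist_add_natDist_le [Nonempty W.Wall] (hch : D.IsOfChains) (hg : D.IsGluable m)
    (hsep : D.IsSeparated 0) (h : ¬ CommonChain o (n + 1) x y) :
    natDist o x + natDist o y ≤ natDist x y + 2 * n + m + 1 := by
  have key : ∀ x y : D.Dual, ¬ CommonChain o (n + 1) x y → ∃ c : Finset W.Wall, ↑c ∈ D.sets ∧
      natDist o x ≤ c.card + n ∧ Separates ↑c x.1 o.1 ∧ Separates ↑c x.1 y.1 ∧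
      ∀ k ∈ c, o.1.choice k = y.1.choice k := by
    intro x y h
    obtain ⟨a, ha, hs, hcard⟩ := exists_chain o x
    refine ⟨a.filter fun k => o.1.choice k = y.1.choice k,
      mem_of_subset ha (Finset.filter_subset _ _), ?_, fun k hk => ?_, fun k hk => ?_,
      fun k hk => (Finset.mem_filter.1 hk).2⟩
    · have h₃ := Finset.card_filter_add_card_filter_not (s := a)
        fun k => o.1.choice k = y.1.choice k
      by_contra hlt
      refine h (CommonChain.anti (by omega) ⟨a.filter fun k => ¬ o.1.choice k = y.1.choice k,
        mem_of_subset ha (Finset.filter_subset _ _), rfl,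
        hs.mono (Finset.coe_subset.2 (Finset.filter_subset _ _)),
        fun k hk => (Finset.mem_filter.1 hk).2⟩)
    · exact (hs k (Finset.mem_filter.1 hk).1).symm
    · rw [← (Finset.mem_filter.1 hk).2]
      exact (hs k (Finset.mem_filter.1 hk).1).symm
  obtain ⟨a, ha, hacard, hao, hay, hoy⟩ := key x y h
  obtain ⟨b, hb, hbcard, hbo, hbx, hox⟩ := key y x fun h' => h h'.symm
  rcases a.eq_empty_or_nonempty with rfl | hne
  · have := card_le_natDist hb hbx.symm
    simp at hacard
    omega
  -- Halfspaces are now seen from `x`, so `t` is the wall of `a` nearest to `o`.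
  obtain ⟨t, hta, ht⟩ := hch.exists_greatest ha hao hne
  obtain ⟨b', hb'b, hcard, hcross⟩ := hsep.exists_subset_not_cross hb t
  have hle := hg.card_add_card_le hch ha (mem_of_subset hb hb'b) hay
    (hbx.symm.mono (Finset.coe_subset.2 hb'b)) (fun h hh k hk => (ht h hh).trans
      (subset_of_not_cross (x := y.1) (hay t hta) (hao t hta) (hox k (hb'b hk)).symm
        (hbx k (hb'b hk)).symm (hcross k hk)))
    (fun h hh hh' => hao h hh (hox h (hb'b hh')).symm)
  omega

/-- A path of points with common chains of length `n` that starts beyond the wall `t` and ends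
before it yields a chain that ends before `t`. -/
theorem exists_chain_of_transGen (hsep : D.IsSeparated 0) {t : W.Wall}
    (ht : o.1.choice t ≠ x.1.choice t) (hxy : Relation.TransGen (CommonChain o n) x y)
    (hty : o.1.choice t = y.1.choice t) :
    ∃ c : Finset W.Wall, ↑c ∈ D.sets ∧ n ≤ c.card + 1 ∧ t ∉ c ∧
      ∀ k ∈ c, o.1.choice k ⊆ o.1.choice t := by
  have key : ∀ y z : D.Dual, CommonChain o n y z → o.1.choice t ≠ y.1.choice t →
      o.1.choice t = z.1.choice t → ∃ c : Finset W.Wall, ↑c ∈ D.sets ∧ n ≤ c.card + 1 ∧ t ∉ c ∧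
      ∀ k ∈ c, o.1.choice k ⊆ o.1.choice t := by
    rintro y z ⟨c, hc, rfl, hcy, hcz⟩ hy hz
    obtain ⟨c', hc'c, hcard, hcross⟩ := hsep.exists_subset_not_cross hc t
    exact ⟨c', mem_of_subset hc hc'c, hcard, fun htc => hcz t (hc'c htc) hz, fun k hk =>
      subset_of_not_cross (hcy k (hc'c hk)) (hcz k (hc'c hk)) hz hy
        fun hcr => hcross k hk hcr.symm⟩
  induction hxy with
  | single h => exact key _ _ h ht hty
  | tail _ h ih =>
    rename_i y z _
    by_cases hy : o.1.choice t = y.1.choice t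
    exacts [ih hy, key _ _ h hy hty]

-- Take a longest chain from `o` to `x` and the first of its walls, `t`, that does not separate `o`
-- from `y`. Some step of the path jumps over `t`, and its common chain leaves at least `n - 1`
-- walls before `t`. Glued to the part of the longest chain that does not separate `o` from `y`,
-- these show that this part is short enough for the rest to have `n - (m + 1)` walls.
open Classical in
theorem CommonChain.of_transGen [Nonempty W.Wall] (hch : D.IsOfChains) (hg : D.IsGluable m)
    (hsep : D.IsSeparated 0) (h : Relation.TransGen (CommonChain o n) x y) :
    CommonChain o (n - (m + 1)) x y := by
  obtain ⟨a, ha, hs, hcard⟩ := exists_chain o x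
  have hB := Finset.filter_subset (fun k => o.1.choice k = y.1.choice k) a
  have hG := Finset.filter_subset (fun k => ¬ o.1.choice k = y.1.choice k) a
  have hcards := Finset.card_filter_add_card_filter_not (s := a)
    fun k => o.1.choice k = y.1.choice k
  suffices hle : n + (a.filter fun k => o.1.choice k = y.1.choice k).card ≤ a.card + m + 1 from
    CommonChain.anti (by omega) ⟨_, mem_of_subset ha hG, rfl, hs.mono (Finset.coe_subset.2 hG),
      fun k hk => (Finset.mem_filter.1 hk).2⟩
  rcases (a.filter fun k => o.1.choice k = y.1.choice k).eq_empty_or_nonempty with he | hne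
  · obtain ⟨z, hz, -⟩ := Relation.TransGen.head'_iff.1 h
    have := hz.le_natDist
    rw [he, Finset.card_empty]
    omega
  obtain ⟨t, htB, ht⟩ := hch.exists_least (mem_of_subset ha hB)
    (hs.mono (Finset.coe_subset.2 hB)) hne
  obtain ⟨c, hc, hcn, htc, hct⟩ := exists_chain_of_transGen hsep (hs t (hB htB)) h
    (Finset.mem_filter.1 htB).2
  have hle := hg.card_add_card_le hch hc (mem_of_subset ha hB)
    (fun k hk => ne_of_subset (hct k hk) (hs t (hB htB))) (hs.mono (Finset.coe_subset.2 hB))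
    (fun h hh k hk => (hct h hh).trans (ht k hk))
    (fun h hh hh' => htc (wall_eq ((ht h hh').antisymm (hct h hh)) ▸ hh))
  omega

/-- The projections of `o` to the walls of a chain from `o` to `x` are close to a geodesic. -/
theorem exists_commonChain_natDist_le [Nonempty W.Wall] (hch : D.IsOfChains) (hg : D.IsGluable m)
    (hn : n ≤ natDist o x) : ∃ z : D.Dual, CommonChain o n z x ∧ natDist o z ≤ n + m := by
  classical
  rcases Nat.eq_zero_or_pos n with rfl | hpos
  · exact ⟨o, commonChain_zero, by simp [natDist, sepDist_self]⟩
  obtain ⟨a, ha, hs, hcard⟩ := exists_chain o x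
  obtain ⟨e, hea, hen, he⟩ := hch.exists_initial ha hs (hn.trans hcard.ge)
  have hse := hs.mono (Finset.coe_subset.2 hea)
  obtain ⟨t, hte, ht⟩ := hch.exists_greatest (mem_of_subset ha hea) hse
    (Finset.card_pos.1 (hen ▸ hpos))
  have htx := hs t (hea hte)
  -- A chain that separates `o` from the gate also separates `o` from `x`, so the gate lies in the
  -- dual space.
  have hdist : sepDist D.sets (gate o.1 x.1 t htx) o.1 < ⊤ := by
    refine lt_of_le_of_lt (sSup_le ?_) (D.sepDist_lt_top o x)
    rintro _ ⟨c, hc, hsc, rfl⟩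
    exact encard_le_sepDist hc fun k hk =>
      ne_of_subset ((choice_ne_gate_iff htx).1 (hsc k hk).symm) htx
  let z : D.Dual := ⟨gate o.1 x.1 t htx, fun s =>
    lt_of_le_of_lt (D.sepDist_triangle _ o.1 _) (WithTop.add_lt_top.2 ⟨hdist, o.2 s⟩)⟩
  refine ⟨z, ⟨e, mem_of_subset ha hea, hen, fun k hk => (choice_ne_gate_iff htx).2 (ht k hk),
    hse⟩, ?_⟩
  obtain ⟨c, hc, hsc, hccard⟩ := exists_chain o z
  have hct : ∀ k ∈ c, o.1.choice k ⊆ o.1.choice t := fun k hk =>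
    (choice_ne_gate_iff htx).1 (hsc k hk)
  have hsub : a \ e ⊆ a := Finset.sdiff_subset
  -- Chains from `o` to `z` go no further than `t`, so the rest of `a` can be glued after them:
  -- `d(o, z) + (d(o, x) - n) ≤ d(o, x) + m`.
  have hle := hg.card_add_card_le hch hc (mem_of_subset ha hsub)
    (fun k hk => ne_of_subset (hct k hk) htx) (hs.mono (Finset.coe_subset.2 hsub))
    (fun h hh k hk => (hct h hh).trans (he t hte k hk))
    (fun h hh hh' => (Finset.mem_sdiff.1 hh').2
      (wall_eq ((he t hte h hh').antisymm (hct h hh)) ▸ hte))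
  have := Finset.card_sdiff_add_card_eq_card hea
  omega

end DualisableSystem
end WallSpace

/-! ### The quasi-isometry to the tree -/

namespace WallSpace.DualisableSystem

variable {S : Type u} {W : WallSpace S} {D : W.DualisableSystem}

/-- The points of the dual space, related at level `n` if a sequence of points joins them in which
common chains of `n` walls separate consecutive points from `o`. -/
def chainRelations [Nonempty W.Wall] (o : D.Dual) : NestedRelations D.Dual where
  rel n := Relation.TransGen (CommonChain o n)
  symm {n _ _} h :=
    have : Std.Symm (CommonChain o n) := ⟨fun _ _ => CommonChain.symm⟩
    Relation.TransGen.stdSymm.symm _ _ h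
  trans h h' := h.trans h'
  anti hnk h := Relation.TransGen.mono (fun _ _ => CommonChain.anti hnk) _ _ h
  total _ _ := .single commonChain_zero

/-- Thus `natDist o x` is the deepest level at which `x` has a class; `x` is sent to the class
there. -/
theorem chainRelations_rel_self_iff [Nonempty W.Wall] {o x : D.Dual} {n : ℕ} :
    (chainRelations o).rel n x x ↔ n ≤ natDist o x := by
  refine ⟨fun h => ?_, fun h => Relation.TransGen.single (commonChain_self_iff.2 h)⟩
  obtain ⟨z, hz, -⟩ := Relation.TransGen.head'_iff.1 h
  exact hz.le_natDist

theorem isQuasitree_dual_of_nonempty [Nonempty S] [Nonempty W.Wall] {m : ℕ} (o : D.Dual)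
    (hch : D.IsOfChains) (hg : D.IsGluable m) (hsep : D.IsSeparated 0) : IsQuasitree D.Dual := by
  classical
  have : Nonempty D.Dual := ⟨o⟩
  have hself : ∀ x : D.Dual, (chainRelations o).rel (natDist o x) x x :=
    fun x => chainRelations_rel_self_iff.2 le_rfl
  -- In `4 * m + 4`, one half is twice the loss `m + 1` of `CommonChain.of_transGen`, the other is
  -- the error `2 * m + 2` of `CommonChain.natDist_add_le`.
  refine ⟨(chainRelations o).Vertex, (chainRelations o).tree,
    fun x => NestedRelations.vertex (hself x), 1, 4 * m + 4, NestedRelations.tree_isTree, le_rfl,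
    by positivity, fun x y => ?_, fun v => ?_⟩
  -- At the last level `j` where `x` and `y` are related their branches part, so the tree distance
  -- is exactly `d(o, x) + d(o, y) - 2j`.
  · obtain ⟨j, hj, hxy, hj'⟩ : ∃ j ≤ natDist o x, (chainRelations o).rel j x y ∧
        ¬ (chainRelations o).rel (j + 1) x y := by
      have hle : ∀ n, (chainRelations o).rel n x y → n ≤ natDist o x := fun n hn =>
        chainRelations_rel_self_iff.1 ((chainRelations o).trans hn ((chainRelations o).symm hn))
      have hspec := Nat.findGreatest_spec (P := fun n => (chainRelations o).rel n x y)
        (Nat.zero_le (natDist o x)) ((chainRelations o).total x y)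
      refine ⟨_, Nat.findGreatest_le _, hspec, fun h => ?_⟩
      have := Nat.le_findGreatest (P := fun n => (chainRelations o).rel n x y) (hle _ h) h
      omega
    have hjy : j ≤ natDist o y := chainRelations_rel_self_iff.1
      ((chainRelations o).trans ((chainRelations o).symm hxy) hxy)
    have h₁ := NestedRelations.dist_vertex_le (hself x) (hself y) hxy hj hjy
    have h₂ := NestedRelations.le_dist_vertex (hself x) (hself y) hj' hj
    have h₃ := (CommonChain.of_transGen hch hg hsep hxy).natDist_add_le hch hg hsep
    have h₄ := natDist_add_natDist_le hch hg hsep fun h => hj' (Relation.TransGen.single h)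
    rw [dist_eq_natDist]
    have h₅ : natDist x y ≤ (chainRelations o).tree.dist (NestedRelations.vertex (hself x))
        (NestedRelations.vertex (hself y)) + (4 * m + 4) := by omega
    have h₆ : (chainRelations o).tree.dist (NestedRelations.vertex (hself x))
        (NestedRelations.vertex (hself y)) ≤ natDist x y + (4 * m + 4) := by omega
    have h₅' : (natDist x y : ℝ) ≤ (chainRelations o).tree.dist (NestedRelations.vertex (hself x))
        (NestedRelations.vertex (hself y)) + (4 * m + 4) := by exact_mod_cast h₅
    have h₆' : ((chainRelations o).tree.dist (NestedRelations.vertex (hself x))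
        (NestedRelations.vertex (hself y)) : ℝ) ≤ natDist x y + (4 * m + 4) := by exact_mod_cast h₆
    constructor <;> linarith
  · obtain ⟨x, hx⟩ := v.nonempty
    have hxx := NestedRelations.Vertex.rel_self hx
    obtain ⟨z, hz, hle⟩ := exists_commonChain_natDist_le hch hg
      (chainRelations_rel_self_iff.1 hxx)
    refine ⟨z, ?_⟩
    rw [NestedRelations.Vertex.eq_vertex hx]
    -- The vertex of `z` lies below `v`, at most `m` levels deeper.
    have h₁ := NestedRelations.dist_vertex_le (E := chainRelations o) (hself z) hxx (Relation.TransGen.single hz)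
      hz.le_natDist le_rfl
    have h₂ : (chainRelations o).tree.dist (NestedRelations.vertex (hself z))
        (NestedRelations.vertex hxx) ≤ 4 * m + 4 := by omega
    exact_mod_cast h₂

theorem nonempty_dual (D : W.DualisableSystem) : Nonempty D.Dual := by
  rcases isEmpty_or_nonempty S with hS | ⟨⟨s⟩⟩
  · refine ⟨⟨⟨fun _ => ∅, fun h => ?_, fun _ _ _ _ _ => Subsingleton.elim _ _⟩, isEmptyElim⟩⟩
    obtain ⟨A, hA⟩ := W.bipartition h.1 h.2
    simp [IsHalfspace, hA, Subsingleton.elim A ∅]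
  · exact ⟨⟨W.pointUltrafilter s, D.finite_sepDist s⟩⟩

end WallSpace.DualisableSystem

theorem isQuasitree_of_subsingleton (X : Type u) [MetricSpace X] [Subsingleton X] [Nonempty X] :
    IsQuasitree X := by
  obtain ⟨x₀⟩ := ‹Nonempty X›
  refine ⟨PUnit, ⊥, fun _ => PUnit.unit, 1, 0, .of_subsingleton, le_rfl, le_rfl, fun x y => ?_,
    fun v => ⟨x₀, by simp⟩⟩
  simp [Subsingleton.elim x y]

theorem mainTheorem10 {S : Type u} (W : WallSpace S) (D : W.DualisableSystem) (m : ℕ)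
    (hchains : D.IsOfChains) (hgluable : D.IsGluable m) (hseparated : D.IsSeparated 0) :
    IsQuasitree D.Dual := by
  have hne := D.nonempty_dual
  -- Without points or without walls there is just one ultrafilter. A wall is also what guarantees
  -- that the empty chain belongs to the system.
  by_cases h : Nonempty S ∧ Nonempty W.Wall
  · obtain ⟨_, _⟩ := h
    exact WallSpace.DualisableSystem.isQuasitree_dual_of_nonempty hne.some hchains hgluable
      hseparated
  · have : Subsingleton D.Dual := ⟨fun x y => Subtype.ext <| WallSpace.WallUltrafilter.ext <|
      funext fun k => by
        have : IsEmpty S := not_nonempty_iff.1 fun hS => h ⟨hS, ⟨k⟩⟩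
        exact Subsingleton.elim _ _⟩
    exact isQuasitree_of_subsingleton D.Dual
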